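/- Let $\Phi$ be an irreducible and reduced (crystallographic) root system in a finite-dimensional real vector space $V$, with Weyl group $W$ and a $W$-invariant scalar product $(\cdot|\cdot)$. Let $\Phi_{\mathrm{lg}}$ be the set of long roots, i.e. those with $(\alpha|\alpha)$ maximal. Fix a basis $\Delta$ of $\Phi$, with positive roots $\Phi^+$, and let $l$ be the length function on $W$ with respect to the simple reflections. For $v,w\in V$ write $v\le w$ if $w-v$ is a linear combination of simple roots with non-negative coefficients. Let $\tilde\alpha$ be the highest root. Let $\mathrm{ht}^\vee(\alpha)$ be the height of the coroot $\alpha^\vee$ with respect to the simple coroots, and define the level of a long root by $L(\alpha)=\mathrm{ht}^\vee(\tilde\alpha)-\mathrm{ht}^\vee(\alpha)$ if $\alpha>0$ and $L(\alpha)=\mathrm{ht}^\vee(\tilde\alpha)-\mathrm{ht}^\vee(\alpha)-1$ if $\alpha<0$. A simple path from a long root $\beta$ to a long root $\alpha$ is a sequence of long roots $\beta=\beta_0,\beta_1,\dots,\beta_k=\alpha$ ($k\ge 0$) together with simple roots $\gamma_1,\dots,\gamma_k$ such that $\beta_i=s_{\gamma_i}(\beta_{i-1})$ and $L(\beta_i)=L(\beta_{i-1})+1$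 for all $i$. Let $\tilde I=\{\gamma\in\Delta : (\tilde\alpha|\gamma)=0\}$, let $\Phi_{\tilde I}^+$ be the set of positive roots in the linear span of $\tilde I$, and let $X_{\tilde I}=\{w\in W : w(\Phi_{\tilde I}^+)\subset\Phi^+\}$. Let $\alpha,\beta$ be long roots. 1. If $x\in W$ satisfies $x(\beta)=\alpha$, then $l(x)\ge |L(\alpha)-L(\beta)|$. 2. There is an $x\in W$ with $x(\beta)=\alpha$ and $l(x)=|L(\alpha)-L(\beta)|$ if and only if there is a simple path from $\beta$ to $\alpha$ or a simple path from $\alpha$ to $\beta$. In this case there is only one such $x$, denoted by $x_{\alpha\beta}$. 3. Suppose $x_{\alpha\beta}$ is defined. If there is a simple path from $\beta$ to $\alpha$, then sending a simple path with labels $\gamma_1,\dots,\gamma_k$ to the word $(s_{\gamma_k},\dots,s_{\gamma_1})$ is a bijection from the simple paths from $\beta$ to $\alpha$ onto the reduced expressions of $x_{\alpha\beta}$. If there is a simple path from $\alpha$ to $\beta$, then sending a simple path with labels $\gamma_1,\dots,\gamma_k$ to the word $(s_{\gamma_1},\dots,s_{\gamma_k})$ is a bijection from the simple paths from $\alpha$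 to $\beta$ onto the reduced expressions of $x_{\alpha\beta}$. 4. If $\alpha\le\beta\le\gamma$ are long roots such that $x_{\alpha\beta}$ and $x_{\beta\gamma}$ are defined, then $x_{\alpha\gamma}$ is defined, $x_{\alpha\gamma}=x_{\alpha\beta}x_{\beta\gamma}$ and $l(x_{\alpha\gamma})=l(x_{\alpha\beta})+l(x_{\beta\gamma})$. 5. For every positive long root $\alpha$, the element $x_{-\alpha,\alpha}$ is defined and equals the reflection $s_\alpha$. 6. The root $\tilde\alpha$ is long. For every long root $\alpha$ there is exactly one $x_\alpha\in X_{\tilde I}$ with $x_\alpha(\tilde\alpha)=\alpha$; the element $x_{\alpha,\tilde\alpha}$ is defined and equals $x_\alpha$. -/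

import Mathlib

namespace LongRoots

set_option linter.unusedSectionVars false

noncomputable section

open RootPairing

section Order

variable {ι V N : Type*} [AddCommGroup V] [Module ℝ V] [AddCommGroup N] [Module ℝ N]
  {P : RootPairing ι ℝ V N}

/-- The order on `V` defined by the base `Δ`: `v ≤ w` when `w - v` is a linear combination of
simple roots with non-negative coefficients. -/
def LE (b : P.Base) (v w : V) : Prop :=
  ∃ c : ι → ℝ, (∀ k ∈ b.support, 0 ≤ c k) ∧ w - v = ∑ k ∈ b.support, c k • P.root k

/-- `θ` is the highest root: every root is `≤ θ`. -/
def IsHighest (b : P.Base) (θ : ι) : Prop := ∀ i, LE b (P.root i) (P.root θ)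

theorem LE.refl (b : P.Base) (v : V) : LE b v v := ⟨0, by simp⟩

theorem LE.trans {b : P.Base} {u v w : V} (h : LE b u v) (h' : LE b v w) : LE b u w := by
  obtain ⟨c, hc, e⟩ := h
  obtain ⟨d, hd, f⟩ := h'
  refine ⟨c + d, fun k hk => add_nonneg (hc k hk) (hd k hk), ?_⟩
  simp only [Pi.add_apply, add_smul, Finset.sum_add_distrib, ← e, ← f]
  abel

theorem exists_coeff_of_isPos (b : P.Base) {i : ι} (hi : b.IsPos i) :
    ∃ f : ι → ℤ, f.support ⊆ b.support ∧ (∀ k, 0 ≤ f k) ∧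
      P.root i = ∑ k ∈ b.support, f k • P.root k := by
  obtain ⟨f, hf, hpos, e⟩ := b.exists_root_eq_sum_int i
  refine ⟨f, hf, ?_, e⟩
  rcases hpos with h | h
  · exact fun k => h.le k
  · exfalso
    rw [Base.isPos_iff, Base.height_eq_sum e] at hi
    exact absurd hi (not_lt.mpr (Finset.sum_nonpos fun k _ => h.le k))

theorem LE.of_sub {b : P.Base} {v w : V} {i : ι} (hi : b.IsPos i) (h : w - v = P.root i) :
    LE b v w := by
  obtain ⟨f, -, hf, e⟩ := exists_coeff_of_isPos b hi
  refine ⟨fun k => (f k : ℝ), fun k _ => Int.cast_nonneg (hf k), ?_⟩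
  rw [h, e]
  exact Finset.sum_congr rfl fun k _ => (Int.cast_smul_eq_zsmul ℝ _ _).symm

section Existence

variable [Finite ι] [P.IsCrystallographic] [P.IsReduced] [P.IsIrreducible]

/-- Auxiliary: `i` has maximal height among the roots above it. -/
def IsMax (b : P.Base) (i : ι) : Prop :=
  ∀ j, LE b (P.root i) (P.root j) → b.height j ≤ b.height i

theorem IsMax.isPos {b : P.Base} {i : ι} (h : IsMax b i) : b.IsPos i := by
  let := P.indexNeg
  rcases Base.IsPos.or_neg b i with hi | hi
  · exact hi
  · have h1 : LE b (P.root i) 0 := LE.of_sub hi (by simp)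
    have h2 : LE b 0 (P.root (-i)) := LE.of_sub hi (by simp)
    have h3 := h _ (h1.trans h2)
    rw [Base.isPos_iff] at hi
    rw [b.height_reflectionPerm_self] at h3 hi
    lia

theorem IsMax.pairing_nonneg {b : P.Base} {i : ι} (h : IsMax b i) {k : ι} (hk : k ∈ b.support) :
    0 ≤ P.pairingIn ℤ i k := by
  let := P.indexNeg
  by_contra! hlt
  have hne : P.root i ≠ - P.root k := by
    intro e
    have e' : i = -k := P.root.injective (by simpa using e)
    have := h.isPos
    rw [e', Base.IsPos.neg_iff_not] at this
    exact this (Base.isPos_of_mem_support hk)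
  obtain ⟨j, hj⟩ := P.root_add_root_mem_of_pairingIn_neg hlt (by
    intro e; exact hne (by simpa using e))
  have h1 := h j (LE.of_sub (Base.isPos_of_mem_support hk) (by rw [hj]; abel))
  rw [b.height_add hj, Base.height_one_of_mem_support hk] at h1
  lia

theorem pairing_eq_sum {b : P.Base} {i : ι} {f : ι → ℤ}
    (e : P.root i = ∑ k ∈ b.support, f k • P.root k) (j : ι) :
    P.pairingIn ℤ i j = ∑ k ∈ b.support, f k * P.pairingIn ℤ k j := by
  apply FaithfulSMul.algebraMap_injective ℤ ℝ
  rw [P.algebraMap_pairingIn, ← P.root_coroot_eq_pairing, e]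
  simp only [map_sum, map_zsmul, LinearMap.coe_sum, Finset.sum_apply, LinearMap.smul_apply,
    P.root_coroot_eq_pairing, map_mul, P.algebraMap_pairingIn, zsmul_eq_mul]
  simp

theorem IsMax.coeff_pos {b : P.Base} {i : ι} (h : IsMax b i) {f : ι → ℤ}
    (hf : ∀ k, 0 ≤ f k) (e : P.root i = ∑ k ∈ b.support, f k • P.root k) {k : ι}
    (hk : k ∈ b.support) : 0 < f k := by
  classical
  let s : Set ι := {l | l ∈ b.support ∧ f l ≠ 0}
  have key : ∀ m ∈ b.support, m ∉ s → ∀ l ∈ s, P.pairing l m = 0 := by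
    intro m hm hms l hl
    have hfm : f m = 0 := by
      by_contra hne
      exact hms ⟨hm, hne⟩
    have hsum := pairing_eq_sum e m
    have h0 := h.pairing_nonneg hm
    have hle : ∀ x ∈ b.support, f x * P.pairingIn ℤ x m ≤ 0 := by
      intro x hx
      rcases eq_or_ne x m with rfl | hxm
      · simp [hfm]
      · exact mul_nonpos_of_nonneg_of_nonpos (hf x) (b.pairingIn_le_zero_of_ne hxm hx hm)
    have hz : ∑ x ∈ b.support, f x * P.pairingIn ℤ x m = 0 :=
      le_antisymm (Finset.sum_nonpos hle) (hsum ▸ h0)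
    have := (Finset.sum_eq_zero_iff_of_nonpos hle).mp hz l hl.1
    have h1 : P.pairingIn ℤ l m = 0 := by
      rcases mul_eq_zero.mp this with h' | h'
      · exact absurd h' hl.2
      · exact h'
    rw [← P.algebraMap_pairingIn ℤ, h1, map_zero]
  let q : Submodule ℝ V := Submodule.span ℝ (P.root '' s)
  have hq : ∀ m, q ∈ Module.End.invtSubmodule (P.reflection m) := by
    rw [← b.forall_mem_support_invtSubmodule_iff]
    intro m hm
    by_cases hms : m ∈ s
    · exact Submodule.mem_invtSubmodule_reflection_of_mem _ _
        (Submodule.subset_span ⟨m, hms, rfl⟩)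
    · have hker : q ≤ LinearMap.ker (P.coroot' m) := by
        refine Submodule.span_le.mpr ?_
        rintro _ ⟨l, hl, rfl⟩
        simpa using key m hm hms l hl
      refine (Module.End.mem_invtSubmodule _).mpr fun x hx => ?_
      have hx0 : P.coroot' m x = 0 := hker hx
      simp only [Submodule.mem_comap, LinearEquiv.coe_coe, reflection_apply, hx0, zero_smul,
        sub_zero]
      exact hx
  have hne : q ≠ ⊥ := by
    intro hbot
    apply P.ne_zero i
    have : P.root i ∈ q := by
      rw [e]
      refine Submodule.sum_mem _ fun l hl => ?_
      by_cases hfl : f l = 0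
      · simp [hfl]
      · rw [← Int.cast_smul_eq_zsmul ℝ]
        exact q.smul_mem _ (Submodule.subset_span ⟨l, ⟨hl, hfl⟩, rfl⟩)
    simpa [hbot] using this
  have htop := IsIrreducible.eq_top_of_invtSubmodule_reflection (P := P) q hq hne
  by_contra hfk
  have hfk0 : f k = 0 := le_antisymm (not_lt.mp hfk) (hf k)
  have hmem : P.root k ∈ Submodule.span ℝ (P.root '' s) := by
    change P.root k ∈ q
    rw [htop]; trivial
  have hks : k ∉ s := fun h' => h'.2 hfk0
  have hins : LinearIndepOn ℝ P.root (insert k s) :=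
    b.linearIndepOn_root.mono (Set.insert_subset hk fun l hl => hl.1)
  exact (linearIndepOn_insert hks).mp hins |>.2 hmem

theorem IsMax.eq {b : P.Base} {i j : ι} (hi : IsMax b i) (hj : IsMax b j) : i = j := by
  let := P.indexNeg
  obtain ⟨f, -, hf, ef⟩ := exists_coeff_of_isPos b hi.isPos
  obtain ⟨g, -, hg, eg⟩ := exists_coeff_of_isPos b hj.isPos
  have hnn : ∀ k ∈ b.support, 0 ≤ P.pairingIn ℤ k i := by
    intro k hk
    by_contra! hlt
    have := (P.pairingIn_lt_zero_iff ℤ).mp hlt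
    exact absurd (hi.pairing_nonneg hk) (not_le.mpr this)
  have hpos : 0 < P.pairingIn ℤ j i := by
    rw [pairing_eq_sum eg i]
    refine Finset.sum_pos' (fun k hk => mul_nonneg (hg k) (hnn k hk)) ?_
    by_contra! hcon
    have h2 : P.pairingIn ℤ i i = 0 := by
      rw [pairing_eq_sum ef i]
      refine Finset.sum_eq_zero fun k hk => ?_
      have h3 := hcon k hk
      have h4 := hj.coeff_pos hg eg hk
      have h5 : P.pairingIn ℤ k i = 0 := by
        refine le_antisymm ?_ (hnn k hk)
        by_contra! h6
        exact absurd (mul_pos h4 h6) (not_lt.mpr h3)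
      rw [h5, mul_zero]
    simp at h2
  by_contra hne
  obtain ⟨k, hk⟩ := P.root_sub_root_mem_of_pairingIn_pos hpos (fun h => hne h.symm)
  have hh := b.height_sub hk
  rcases Base.IsPos.or_neg b k with hk' | hk'
  · have := hi j (LE.of_sub hk' hk.symm)
    rw [Base.isPos_iff] at hk'
    lia
  · have := hj i (LE.of_sub hk' (by
      have hneg : P.root (-k) = -P.root k := by simp
      rw [hneg, hk]
      abel))
    rw [Base.isPos_iff, b.height_reflectionPerm_self] at hk'
    lia

theorem exists_isMax_above (b : P.Base) (j : ι) :
    ∃ i, LE b (P.root j) (P.root i) ∧ IsMax b i := by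
  obtain ⟨i, hi, hmax⟩ := Set.exists_max_image {i | LE b (P.root j) (P.root i)} b.height
    (Set.toFinite _) ⟨j, LE.refl b _⟩
  exact ⟨i, hi, fun k hk => hmax k (LE.trans hi hk)⟩

theorem nonempty_index (P : RootPairing ι ℝ V N) [P.IsRootSystem] [P.IsIrreducible] :
    Nonempty ι := by
  by_contra h
  rw [not_nonempty_iff] at h
  have := IsIrreducible.nontrivial P
  have h1 := IsRootSystem.span_root_eq_top (P := P)
  rw [Set.range_eq_empty, Submodule.span_empty] at h1
  exact bot_ne_top h1

theorem exists_isHighest [P.IsRootSystem] (b : P.Base) : ∃ θ, IsHighest b θ := by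
  obtain ⟨j⟩ := nonempty_index P
  obtain ⟨θ, -, hθ⟩ := exists_isMax_above b j
  refine ⟨θ, fun i => ?_⟩
  obtain ⟨k, hk, hk'⟩ := exists_isMax_above b i
  rwa [hk'.eq hθ] at hk

/-- The (index of the) highest root `α̃` of an irreducible root system. -/
def highestRoot [P.IsRootSystem] (b : P.Base) : ι := (exists_isHighest b).choose

theorem highestRoot_isHighest [P.IsRootSystem] (b : P.Base) : IsHighest b (highestRoot b) :=
  (exists_isHighest b).choose_spec

end Existence

end Order

section Length

variable {ι V N : Type*} [AddCommGroup V] [Module ℝ V] [AddCommGroup N] [Module ℝ N]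
  {P : RootPairing ι ℝ V N}

/-- The product `s_{γ₁} ⋯ s_{γₖ}` in the Weyl group, for a word `[γ₁, …, γₖ]` in the simple
roots. -/
def wordProd (b : P.Base) (ω : List b.support) : P.weylGroup :=
  (ω.map fun γ => weylGroup.ofIdx P (γ : ι)).prod

theorem ofIdx_eq_of_smul (i : ι) (g : P.weylGroup)
    (h : ∀ v : V, g • v = P.reflection i v) : weylGroup.ofIdx P i = g := by
  apply Subtype.ext
  apply RootPairing.Equiv.weightHom_injective P
  ext v
  exact (h v).symm

/-- Every element of the Weyl group is a product of simple reflections. -/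
theorem exists_wordProd_eq [Finite ι] [P.IsCrystallographic] [P.IsReduced] (b : P.Base)
    (w : P.weylGroup) : ∃ ω : List b.support, wordProd b ω = w := by
  have hmul : ∀ ω ω' : List b.support, wordProd b (ω ++ ω') = wordProd b ω * wordProd b ω' := by
    intro ω ω'
    simp [wordProd]
  have hrefl : ∀ i, ∃ ω : List b.support, wordProd b ω = weylGroup.ofIdx P i := by
    intro i
    refine b.induction_reflect i
      (p := fun i => ∃ ω : List b.support, wordProd b ω = weylGroup.ofIdx P i) ?_ ?_ ?_
    · rintro i ⟨ω, hω⟩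
      refine ⟨ω, hω.trans (ofIdx_eq_of_smul _ _ fun v => ?_).symm⟩
      change P.reflection i v = _
      simp [reflection_apply]
      module
    · intro i hi
      exact ⟨[⟨i, hi⟩], by simp [wordProd]⟩
    · rintro i j ⟨ω, hω⟩ hj
      refine ⟨[⟨j, hj⟩] ++ ω ++ [⟨j, hj⟩], ?_⟩
      rw [hmul, hmul, hω]
      refine (ofIdx_eq_of_smul _ _ fun v => ?_).symm
      rw [reflection_reflectionPerm]
      simp only [wordProd, mul_smul]
      rfl
  obtain ⟨g, hg⟩ := w
  induction hg using weylGroup.induction with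
  | mem i => exact hrefl i
  | one => exact ⟨[], rfl⟩
  | mul x y hx hy ihx ihy =>
    obtain ⟨ω, h⟩ := ihx
    obtain ⟨ω', h'⟩ := ihy
    exact ⟨ω ++ ω', by rw [hmul, h, h']; rfl⟩

/-- The length of a Weyl group element: the least number of factors in an expression of it as a
product of simple reflections. -/
def length (b : P.Base) (w : P.weylGroup) : ℕ :=
  sInf {n | ∃ ω : List b.support, wordProd b ω = w ∧ ω.length = n}

/-- `ω` is a reduced expression of `w`. -/
def IsReducedExpr (b : P.Base) (w : P.weylGroup) (ω : List b.support) : Prop :=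
  wordProd b ω = w ∧ ω.length = length b w

end Length

section Long

variable {ι V N : Type*} [AddCommGroup V] [Module ℝ V] [AddCommGroup N] [Module ℝ N]

/-- `B` is a scalar product on `V` invariant under the Weyl group. -/
structure IsInvariantScalarProduct (P : RootPairing ι ℝ V N) (B : LinearMap.BilinForm ℝ V) :
    Prop where
  symm : ∀ v w, B v w = B w v
  pos : ∀ v, v ≠ 0 → 0 < B v v
  invariant : ∀ (x : P.weylGroup) (v w : V), B (x • v) (x • w) = B v w

/-- `α` is a long root: its squared length `(α|α)` is the maximum of the squared lengths of the
roots. -/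
def IsLong (P : RootPairing ι ℝ V N) (B : LinearMap.BilinForm ℝ V) (α : ι) : Prop :=
  ∀ j, B (P.root j) (P.root j) ≤ B (P.root α) (P.root α)

variable {P : RootPairing ι ℝ V N}

/-- The dual height `ht^∨(α)`: the height of the coroot `α^∨` with respect to the simple
coroots. -/
def dualHeight (b : P.Base) (α : ι) : ℤ := b.flip.height α

variable [Finite ι] [P.IsRootSystem] [P.IsCrystallographic] [P.IsReduced] [P.IsIrreducible]

open Classical in
/-- The level `L(α)`. -/
def level (b : P.Base) (α : ι) : ℤ :=
  if b.IsPos α then dualHeight b (highestRoot b) - dualHeight b α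
  else dualHeight b (highestRoot b) - dualHeight b α - 1

/-- The relation `β --γ--> α` between long roots `β`, `α`, for a positive root `γ`. -/
structure Step (b : P.Base) (B : LinearMap.BilinForm ℝ V) (β γ α : ι) : Prop where
  long_source : IsLong P B β
  long_target : IsLong P B α
  pos : b.IsPos γ
  reflection_eq : P.root α = P.reflection γ (P.root β)
  level_eq : level b α = level b β + 1

/-- The type of simple paths
`β = β₀ --γ₁--> β₁ --γ₂--> ⋯ --γₖ--> βₖ = α` of long roots, all `γᵢ` being simple roots (`k = 0`
is allowed). -/
inductive SimplePath (b : P.Base) (B : LinearMap.BilinForm ℝ V) : ι → ι → Type _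
  | nil (β : ι) (hβ : IsLong P B β) : SimplePath b B β β
  | snoc {β δ α : ι} (p : SimplePath b B β δ) (γ : b.support) (h : Step b B δ γ α) :
      SimplePath b B β α

/-- The word `[γₖ, …, γ₁]` of the labels of a simple path, the last step first. -/
def SimplePath.word {b : P.Base} {B : LinearMap.BilinForm ℝ V} {β α : ι} :
    SimplePath b B β α → List b.support
  | .nil _ _ => []
  | .snoc p γ _ => γ :: p.word

/-- `x(β) = α` and `l(x) = |L(α) - L(β)|`, the defining properties of the element `x_{αβ}`. -/
def IsMinimal (b : P.Base) (x : P.weylGroup) (α β : ι) : Prop :=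
  x • P.root β = P.root α ∧ (length b x : ℤ) = |level b α - level b β|

/-- The set `Ĩ` of simple roots orthogonal to the highest root. -/
def orthSimple (b : P.Base) (B : LinearMap.BilinForm ℝ V) : Set ι :=
  {i | i ∈ b.support ∧ B (P.root (highestRoot b)) (P.root i) = 0}

/-- The set `X_Ĩ` of distinguished coset representatives: the `w ∈ W` that send every positive
root in the span of `Ĩ` to a positive root. -/
def distinguished (b : P.Base) (B : LinearMap.BilinForm ℝ V) : Set P.weylGroup :=
  {w | ∀ i, b.IsPos i → P.root i ∈ Submodule.span ℝ (P.root '' orthSimple b B) →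
    ∃ j, b.IsPos j ∧ w • P.root i = P.root j}

end Long

end

end LongRoots

namespace LongRoots

noncomputable section

open RootPairing

/-! ### Words in the simple reflections and the length function. -/

section WeylGroup

variable {ι V N : Type*} [AddCommGroup V] [Module ℝ V] [AddCommGroup N] [Module ℝ N]
  {P : RootPairing ι ℝ V N}

/-! The level is built so that a simple reflection `s_γ` changes the level of a long root `β` by
exactly the sign of `⟨γ, β^∨⟩` (`level_reflection`). If `γ ≠ ±β`, maximality of the length of `β`
forces `⟨γ, β^∨⟩` into `{-1, 0, 1}`, and this number is subtracted from the dual height. If `γ =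
±β`, the dual height jumps between `1` and `-1`, and the extra `-1` in the level of negative roots
reduces this jump to one.

Hence a word moves the level by at most its number of letters, which is the lower bound on the
length. Equality means that every letter moves the level by one in the same direction, so the
reduced expressions of a minimal element are exactly the label words of simple paths
(`exists_simplePath_of_word`).

Uniqueness passes through the highest root `θ`. A long root other than `θ` is not dominant, so some
simple reflection lowers its level, and descent yields a simple path from `θ`. A minimal element
starting at `θ` is distinguished: otherwise, by the exchange property, a shorter element would have
the same effect on `θ`. Distinguished elements are determined by their value at `θ`
(`distinguished_unique`). Composing with a path from `θ` to `β` and cancelling settles arbitrary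
pairs.

For `s_α`, repeated conjugation by simple reflections bounds the length by `2 ht^∨(α) - 1`, which is
the level difference of `-α` and `α`. -/

theorem ofIdx_smul_eq (i : ι) (v : V) : weylGroup.ofIdx P i • v = P.reflection i v := rfl

theorem ofIdx_mul_self (i : ι) : weylGroup.ofIdx P i * weylGroup.ofIdx P i = 1 := by
  apply Subtype.ext
  apply RootPairing.Equiv.weightHom_injective P
  ext v
  exact P.reflection_same i v

theorem ofIdx_inv (i : ι) : (weylGroup.ofIdx P i)⁻¹ = weylGroup.ofIdx P i :=
  inv_eq_of_mul_eq_one_left (ofIdx_mul_self i)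

theorem smul_real (x : P.weylGroup) (c : ℝ) (v : V) : x • (c • v) = c • (x • v) :=
  map_smul ((RootPairing.Equiv.weightHom P) x.1) c v

theorem exists_root_eq_smul (x : P.weylGroup) (i : ι) : ∃ j, P.root j = x • P.root i :=
  ⟨_, (P.weylGroup_apply_root x i).symm⟩

theorem wordProd_cons (b : P.Base) (γ : b.support) (ω : List b.support) :
    wordProd b (γ :: ω) = weylGroup.ofIdx P γ * wordProd b ω := by simp [wordProd]

theorem wordProd_append (b : P.Base) (ω ω' : List b.support) :
    wordProd b (ω ++ ω') = wordProd b ω * wordProd b ω' := by simp [wordProd]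

theorem wordProd_reverse (b : P.Base) (ω : List b.support) :
    wordProd b ω.reverse = (wordProd b ω)⁻¹ := by
  induction ω with
  | nil => simp [wordProd]
  | cons γ ω ih =>
    rw [List.reverse_cons, wordProd_append, ih, wordProd_cons b γ ω, mul_inv_rev, ofIdx_inv]
    simp [wordProd]

theorem length_wordProd_le (b : P.Base) (ω : List b.support) :
    length b (wordProd b ω) ≤ ω.length := Nat.sInf_le ⟨ω, rfl, rfl⟩

theorem length_ofIdx_le (b : P.Base) {γ : ι} (hγ : γ ∈ b.support) :
    length b (weylGroup.ofIdx P γ) ≤ 1 := by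
  simpa [wordProd] using length_wordProd_le b [⟨γ, hγ⟩]

section

variable [Finite ι] [P.IsCrystallographic] [P.IsReduced]

theorem exists_isReducedExpr (b : P.Base) (w : P.weylGroup) : ∃ ω, IsReducedExpr b w ω := by
  obtain ⟨ω, h⟩ := exists_wordProd_eq b w
  exact Nat.sInf_mem (s := {n | ∃ ω : List b.support, wordProd b ω = w ∧ ω.length = n})
    ⟨_, ω, h, rfl⟩

theorem length_mul_le (b : P.Base) (x y : P.weylGroup) :
    length b (x * y) ≤ length b x + length b y := by
  obtain ⟨ω, rfl, h⟩ := exists_isReducedExpr b x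
  obtain ⟨ω', rfl, h'⟩ := exists_isReducedExpr b y
  rw [← h, ← h', ← wordProd_append, ← List.length_append]
  exact length_wordProd_le b _

theorem length_inv (b : P.Base) (x : P.weylGroup) : length b x⁻¹ = length b x := by
  have key : ∀ y : P.weylGroup, length b y⁻¹ ≤ length b y := by
    intro y
    obtain ⟨ω, rfl, h⟩ := exists_isReducedExpr b y
    rw [← h, ← wordProd_reverse, ← List.length_reverse]
    exact length_wordProd_le b _
  refine le_antisymm (key x) ?_
  simpa using key x⁻¹

theorem IsReducedExpr.reverse {b : P.Base} {x : P.weylGroup} {ω : List b.support}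
    (h : IsReducedExpr b x ω) : IsReducedExpr b x⁻¹ ω.reverse :=
  ⟨by rw [wordProd_reverse, h.1], by rw [List.length_reverse, length_inv, h.2]⟩

end

end WeylGroup

/-! ### Height as a linear functional. -/

section Functionals

variable {ι V N : Type*} [AddCommGroup V] [Module ℝ V] [AddCommGroup N] [Module ℝ N]
  {P : RootPairing ι ℝ V N} [P.IsRootSystem]

/-- The linear functional on `V` taking the value `c k` on each simple root `k`. -/
def simpleFunctional (b : P.Base) (c : ι → ℝ) : V →ₗ[ℝ] ℝ :=
  b.toWeightBasis.constr ℝ fun k => c k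

theorem simpleFunctional_apply (b : P.Base) (c : ι → ℝ) {k : ι} (hk : k ∈ b.support) :
    simpleFunctional b c (P.root k) = c k := by
  have := b.toWeightBasis.constr_basis ℝ (fun k : b.support => c k) ⟨k, hk⟩
  rwa [Base.toWeightBasis_apply] at this

/-- The linear extension of the height to `V`. -/
def ht (b : P.Base) : V →ₗ[ℝ] ℝ := simpleFunctional b 1

theorem ht_root (b : P.Base) (i : ι) : ht b (P.root i) = b.height i := by
  obtain ⟨f, -, -, e⟩ := b.exists_root_eq_sum_int i
  rw [Base.height_eq_sum e, e, map_sum, Int.cast_sum]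
  refine Finset.sum_congr rfl fun k hk => ?_
  rw [map_zsmul, ht, simpleFunctional_apply b _ hk]
  simp

/-- Positivity becomes the sign of a linear functional, so it can be tested on vectors `x • P.root
i` and on real combinations of simple roots. -/
theorem isPos_iff_ht {b : P.Base} {i : ι} : b.IsPos i ↔ 0 < ht b (P.root i) := by
  rw [ht_root, Base.isPos_iff, Int.cast_pos]

theorem ht_root_ne_zero (b : P.Base) (i : ι) : ht b (P.root i) ≠ 0 := by
  rw [ht_root]; exact_mod_cast b.height_ne_zero i

theorem not_isPos_iff_ht {b : P.Base} {i : ι} : ¬ b.IsPos i ↔ ht b (P.root i) < 0 := by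
  rw [isPos_iff_ht, not_lt, le_iff_lt_or_eq, or_iff_left (ht_root_ne_zero b i)]

theorem ht_reflection {b : P.Base} {γ : ι} (hγ : γ ∈ b.support) (i : ι) :
    ht b (P.reflection γ (P.root i)) = ht b (P.root i) - P.pairing i γ := by
  rw [reflection_apply_root, map_sub, map_smul, ht, simpleFunctional_apply b _ hγ]
  simp

theorem dualHeight_cast (b : P.Base) (i : ι) :
    (dualHeight b i : ℝ) = ht (P := P.flip) b.flip (P.coroot i) :=
  (ht_root (P := P.flip) b.flip i).symm

omit [P.IsRootSystem] in
theorem exists_real_coeff {b : P.Base} {i : ι} (hi : b.IsPos i) :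
    ∃ c : ι → ℝ, (∀ k, 0 ≤ c k) ∧ P.root i = ∑ k ∈ b.support, c k • P.root k := by
  obtain ⟨f, -, hf, e⟩ := exists_coeff_of_isPos b hi
  refine ⟨fun k => (f k : ℝ), fun k => Int.cast_nonneg (hf k), e.trans ?_⟩
  exact Finset.sum_congr rfl fun k _ => (Int.cast_smul_eq_zsmul ℝ _ _).symm

omit [P.IsRootSystem] in
theorem exists_neg (P : RootPairing ι ℝ V N) (i : ι) : ∃ j, P.root j = -P.root i :=
  ⟨_, (P.root_reflectionPerm i i).trans (P.reflection_apply_self i)⟩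

end Functionals

/-! ### The invariant scalar product. -/

section Form

variable {ι V N : Type*} [AddCommGroup V] [Module ℝ V] [AddCommGroup N] [Module ℝ N]
  {P : RootPairing ι ℝ V N} {B : LinearMap.BilinForm ℝ V}

namespace IsInvariantScalarProduct

variable (hB : IsInvariantScalarProduct P B)
include hB

theorem nonneg (v : V) : 0 ≤ B v v := by
  rcases eq_or_ne v 0 with rfl | h
  · simp
  · exact (hB.pos v h).le

theorem eq_zero_of_le {v : V} (h : B v v ≤ 0) : v = 0 := by
  by_contra hne
  exact absurd (hB.pos v hne) (not_lt.mpr h)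

theorem root_pos (i : ι) : 0 < B (P.root i) (P.root i) := hB.pos _ (P.ne_zero i)

/-- Invariance under `s_i`, which negates the root `i`, ties the coroot to the form: `i^∨` acts as
`2(·|i)/(i|i)`. -/
theorem two_mul_apply_root (v : V) (i : ι) :
    2 * B v (P.root i) = P.coroot' i v * B (P.root i) (P.root i) := by
  have h := hB.invariant (weylGroup.ofIdx P i) v (P.root i)
  rw [ofIdx_smul_eq, ofIdx_smul_eq, reflection_apply_self, reflection_apply] at h
  simp only [map_neg, map_sub, map_smul, LinearMap.sub_apply, LinearMap.smul_apply,
    smul_eq_mul] at h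
  linarith

theorem two_mul_apply_root_root (j i : ι) :
    2 * B (P.root j) (P.root i) = P.pairing j i * B (P.root i) (P.root i) :=
  hB.two_mul_apply_root (P.root j) i

theorem apply_reflection (γ : ι) (v w : V) :
    B (P.reflection γ v) (P.reflection γ w) = B v w :=
  hB.invariant (weylGroup.ofIdx P γ) v w

theorem conj_ofIdx {w : P.weylGroup} {i j : ι} (h : P.root j = w • P.root i) :
    weylGroup.ofIdx P j = w * weylGroup.ofIdx P i * w⁻¹ := by
  refine ofIdx_eq_of_smul _ _ fun v => ?_
  have hc : P.coroot' j v = P.coroot' i (w⁻¹ • v) := by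
    have h1 := hB.two_mul_apply_root v j
    have h2 := hB.two_mul_apply_root (w⁻¹ • v) i
    have h3 := hB.invariant w (w⁻¹ • v) (P.root i)
    have h4 := hB.invariant w (P.root i) (P.root i)
    rw [smul_inv_smul, ← h] at h3
    rw [← h] at h4
    rw [h3, h4, h2] at h1
    exact (mul_right_cancel₀ (hB.root_pos i).ne' h1).symm
  rw [mul_smul, mul_smul, ofIdx_smul_eq, reflection_apply, reflection_apply, smul_sub,
    smul_inv_smul, smul_real, ← h, hc]

/-- The dual height is not linear in the root, but becomes so after multiplication by the squared
length, because `(i|i) i^∨` corresponds to `2i` under the form. On roots of equal length it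
therefore behaves like a linear functional with positive values on the simple roots. -/
theorem dualHeight_mul [P.IsRootSystem] (b : P.Base) (i : ι) :
    dualHeight b i * B (P.root i) (P.root i) =
      simpleFunctional b (fun k => B (P.root k) (P.root k)) (P.root i) := by
  -- `φ` is the identification of `V` with `N` given by `2B`, prescribed on the simple roots; `h1`
  -- checks this, and the perfect pairing then forces `φ` to send every root `i` to `(i|i) i^∨`.
  let φ : V →ₗ[ℝ] N :=
    b.toWeightBasis.constr ℝ fun k => B (P.root k) (P.root k) • P.coroot k
  have hφ : ∀ k : b.support, φ (P.root k) = B (P.root k) (P.root k) • P.coroot k := by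
    intro k
    have := b.toWeightBasis.constr_basis ℝ
      (fun k : b.support => B (P.root k) (P.root k) • P.coroot k) k
    rwa [Base.toWeightBasis_apply] at this
  have h1 : ∀ v, P.toLinearMap.compl₂ φ v = (2 • B) v := by
    intro v
    refine b.toWeightBasis.ext fun k => ?_
    rw [Base.toWeightBasis_apply, LinearMap.compl₂_apply, hφ, map_smul, smul_eq_mul, mul_comm]
    have := hB.two_mul_apply_root v k
    simp only [LinearMap.smul_apply, nsmul_eq_mul, Nat.cast_ofNat]
    exact this.symm
  have h2 : φ (P.root i) = B (P.root i) (P.root i) • P.coroot i := by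
    apply (LinearMap.IsPerfPair.bijective_right P.toLinearMap).injective
    ext v
    have h3 := LinearMap.congr_fun (h1 v) (P.root i)
    rw [LinearMap.compl₂_apply] at h3
    have h4 := hB.two_mul_apply_root v i
    simp only [LinearMap.smul_apply, nsmul_eq_mul, Nat.cast_ofNat] at h3
    rw [LinearMap.flip_apply, LinearMap.flip_apply, h3, h4, map_smul, smul_eq_mul, mul_comm]
    rfl
  have h5 : ht (P := P.flip) b.flip ∘ₗ φ =
      simpleFunctional b (fun k => B (P.root k) (P.root k)) := by
    refine b.toWeightBasis.ext fun k => ?_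
    rw [Base.toWeightBasis_apply, LinearMap.comp_apply, hφ, map_smul,
      simpleFunctional_apply b _ k.2, smul_eq_mul]
    have : ht (P := P.flip) b.flip (P.coroot k) = 1 :=
      simpleFunctional_apply (P := P.flip) b.flip 1 k.2
    rw [this, mul_one]
  rw [← h5, LinearMap.comp_apply, h2, map_smul, smul_eq_mul, mul_comm, dualHeight_cast]

end IsInvariantScalarProduct

/-! ### Sign and monotonicity of the dual height. -/

section Dual

variable [P.IsRootSystem] (hB : IsInvariantScalarProduct P B)
include hB

theorem dualHeight_pos_iff {b : P.Base} {i : ι} : 0 < dualHeight b i ↔ b.IsPos i := by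
  have key : ∀ j, b.IsPos j → 0 < dualHeight b j := by
    intro j hj
    obtain ⟨c, hc, e⟩ := exists_real_coeff hj
    have h1 : 0 ≤ dualHeight b j * B (P.root j) (P.root j) := by
      rw [hB.dualHeight_mul b j, e, map_sum]
      refine Finset.sum_nonneg fun k hk => ?_
      rw [map_smul, simpleFunctional_apply b _ hk]
      exact mul_nonneg (hc k) (hB.nonneg _)
    have h2 := nonneg_of_mul_nonneg_left h1 (hB.root_pos j)
    have h3 : dualHeight b j ≠ 0 := b.flip.height_ne_zero j
    have h4 : 0 ≤ dualHeight b j := by exact_mod_cast h2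
    lia
  refine ⟨fun h => ?_, key i⟩
  let := P.indexNeg
  refine (Base.IsPos.or_neg b i).resolve_right fun h' => ?_
  have h1 := key _ h'
  have h2 : dualHeight b (-i) = - dualHeight b i := b.flip.height_reflectionPerm_self i
  lia

theorem dualHeight_le_of_LE {b : P.Base} {i j : ι}
    (he : B (P.root i) (P.root i) = B (P.root j) (P.root j))
    (h : LE b (P.root i) (P.root j)) : dualHeight b i ≤ dualHeight b j := by
  obtain ⟨c, hc, e⟩ := h
  have h1 : 0 ≤ (dualHeight b j - dualHeight b i : ℝ) * B (P.root j) (P.root j) := by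
    rw [sub_mul, ← he, hB.dualHeight_mul b i, he, hB.dualHeight_mul b j, ← map_sub, e, map_sum]
    refine Finset.sum_nonneg fun k hk => ?_
    rw [map_smul, simpleFunctional_apply b _ hk]
    exact mul_nonneg (hc k hk) (hB.nonneg _)
  have h2 := nonneg_of_mul_nonneg_left h1 (hB.root_pos j)
  have h3 : (dualHeight b i : ℝ) ≤ dualHeight b j := by linarith
  exact_mod_cast h3

end Dual

/-! ### The exchange property. -/

section Exchange

variable [P.IsRootSystem] [Finite ι] [P.IsCrystallographic] [P.IsReduced]
  (hB : IsInvariantScalarProduct P B) {b : P.Base}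

omit hB in
theorem ht_reflection_pos {γ i : ι} (hγ : γ ∈ b.support) (hi : b.IsPos i) (hne : i ≠ γ) :
    0 < ht b (P.reflection γ (P.root i)) := by
  rw [← P.root_reflectionPerm, ← isPos_iff_ht]
  exact hi.reflectionPerm hγ hne

include hB

/-- Reading the word from the right, the image of `γ` starts positive and ends negative. The letter
`δ` at which the sign changes must meet the root `δ` itself, since `s_δ` permutes the other positive
roots; that letter can then be deleted. -/
theorem exchange {γ : ι} (hγ : γ ∈ b.support) (ω : List b.support)
    (h : ht b (wordProd b ω • P.root γ) < 0) :
    ∃ ω' : List b.support, ω'.length + 1 = ω.length ∧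
      wordProd b ω' = wordProd b ω * weylGroup.ofIdx P γ := by
  induction ω with
  | nil =>
    rw [show wordProd b [] = 1 from rfl, one_smul] at h
    exact absurd h (not_lt.mpr (isPos_iff_ht.mp (Base.isPos_of_mem_support hγ)).le)
  | cons δ ω ih =>
    obtain ⟨j, hj⟩ := exists_root_eq_smul (wordProd b ω) γ
    rw [wordProd_cons, mul_smul, ofIdx_smul_eq, ← hj] at h
    by_cases hpos : b.IsPos j
    · have hjδ : j = δ := by
        by_contra hne
        exact absurd h (not_lt.mpr (ht_reflection_pos δ.2 hpos hne).le)
      refine ⟨ω, rfl, ?_⟩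
      -- With `w` the tail and `wγ = δ`, one has `s_δ = w s_γ w⁻¹`, so `s_δ w s_γ = w`.
      rw [wordProd_cons, ← hjδ, hB.conj_ofIdx hj]
      simp [mul_assoc, ofIdx_mul_self]
    · rw [not_isPos_iff_ht, hj] at hpos
      obtain ⟨ω', hl, e⟩ := ih hpos
      exact ⟨δ :: ω', by simp [hl], by rw [wordProd_cons, wordProd_cons, e, mul_assoc]⟩

theorem length_mul_ofIdx_lt {γ : ι} (hγ : γ ∈ b.support) {x : P.weylGroup}
    (h : ht b (x • P.root γ) < 0) : length b (x * weylGroup.ofIdx P γ) < length b x := by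
  obtain ⟨ω, rfl, hl⟩ := exists_isReducedExpr b x
  obtain ⟨ω', hl', e⟩ := exchange hB hγ ω h
  rw [← e]
  have := length_wordProd_le b ω'
  lia

theorem eq_one_of_forall_ht_pos {x : P.weylGroup}
    (h : ∀ k ∈ b.support, 0 < ht b (x • P.root k)) : x = 1 := by
  obtain ⟨ω, rfl, hl⟩ := exists_isReducedExpr b x
  rcases List.eq_nil_or_concat ω with rfl | ⟨ω, γ, rfl⟩
  · rfl
  exfalso
  have e : wordProd b (ω ++ [γ]) = wordProd b ω * weylGroup.ofIdx P γ := by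
    rw [wordProd_append]; simp [wordProd]
  rw [List.concat_eq_append] at *
  -- For the last letter `γ` of a reduced word `w = w' s_γ`, positivity of `wγ` makes `w'γ`
  -- negative, so `w` would be shorter than `w'`.
  have h1 := h γ γ.2
  rw [e, mul_smul, ofIdx_smul_eq, reflection_apply_self, smul_neg, map_neg] at h1
  have h2 := length_mul_ofIdx_lt hB γ.2 (neg_pos.mp h1)
  have h3 := length_wordProd_le b ω
  rw [e, List.length_append, List.length_singleton] at hl
  lia

end Exchange

/-! ### The highest root and the distinguished representatives. -/

section Highest

variable [P.IsRootSystem] [Finite ι] [P.IsCrystallographic] [P.IsReduced] [P.IsIrreducible]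
  {b : P.Base}

theorem ht_le_ht_highestRoot (i : ι) :
    ht b (P.root i) ≤ ht b (P.root (highestRoot b)) := by
  obtain ⟨c, hc, e⟩ := highestRoot_isHighest b i
  rw [← sub_nonneg, ← map_sub, e, map_sum]
  refine Finset.sum_nonneg fun k hk => ?_
  rw [map_smul, ht, simpleFunctional_apply b _ hk]
  simpa using hc k hk

theorem isPos_highestRoot : b.IsPos (highestRoot b) := by
  obtain ⟨j, hj⟩ := exists_neg P (highestRoot b)
  have h := ht_le_ht_highestRoot (b := b) j
  rw [isPos_iff_ht]
  rw [hj, map_neg] at h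
  have := ht_root_ne_zero b (highestRoot b)
  exact lt_of_le_of_ne (by linarith) this.symm

variable (hB : IsInvariantScalarProduct P B)
include hB

theorem highestRoot_dominant {k : ι} (hk : k ∈ b.support) :
    0 ≤ B (P.root (highestRoot b)) (P.root k) := by
  have h := ht_le_ht_highestRoot (b := b) (P.reflectionPerm k (highestRoot b))
  rw [P.root_reflectionPerm, ht_reflection hk _] at h
  have h1 := hB.two_mul_apply_root_root (highestRoot b) k
  have h2 := mul_nonneg (by linarith : 0 ≤ P.pairing (highestRoot b) k) (hB.nonneg (P.root k))
  linarith

theorem highestRoot_apply_nonneg {i : ι} (hi : b.IsPos i) :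
    0 ≤ B (P.root (highestRoot b)) (P.root i) := by
  obtain ⟨c, hc, e⟩ := exists_real_coeff hi
  rw [e, map_sum]
  refine Finset.sum_nonneg fun k hk => ?_
  rw [map_smul]
  exact mul_nonneg (hc k) (highestRoot_dominant hB hk)

/-- Since the highest root is dominant, its product with a positive root is a sum of non-negative
terms; when it vanishes, every term does. -/
theorem exists_orthSimple_coeff {i : ι} (hi : b.IsPos i)
    (h : B (P.root (highestRoot b)) (P.root i) = 0) :
    ∃ c : ι → ℝ, (∀ k, 0 ≤ c k) ∧ (∀ k ∈ b.support, k ∉ orthSimple b B → c k = 0) ∧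
      P.root i = ∑ k ∈ b.support, c k • P.root k := by
  obtain ⟨c, hc, e⟩ := exists_real_coeff hi
  refine ⟨c, hc, fun k hk hk' => ?_, e⟩
  rw [e, map_sum, Finset.sum_eq_zero_iff_of_nonneg fun k hk => by
    rw [map_smul]; exact mul_nonneg (hc k) (highestRoot_dominant hB hk)] at h
  have h1 := h k hk
  rw [map_smul, smul_eq_mul] at h1
  exact (mul_eq_zero.mp h1).resolve_right fun h2 => hk' ⟨hk, h2⟩

theorem mem_span_orthSimple {i : ι} (hi : b.IsPos i)
    (h : B (P.root (highestRoot b)) (P.root i) = 0) :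
    P.root i ∈ Submodule.span ℝ (P.root '' orthSimple b B) := by
  obtain ⟨c, -, hc, e⟩ := exists_orthSimple_coeff hB hi h
  rw [e]
  refine Submodule.sum_mem _ fun k hk => ?_
  by_cases hk' : k ∈ orthSimple b B
  · exact Submodule.smul_mem _ _ (Submodule.subset_span ⟨k, hk', rfl⟩)
  · rw [hc k hk hk', zero_smul]; exact Submodule.zero_mem _

omit hB in
theorem apply_eq_zero_of_mem_span {v : V}
    (hv : v ∈ Submodule.span ℝ (P.root '' orthSimple b B)) :
    B (P.root (highestRoot b)) v = 0 := by
  have : Submodule.span ℝ (P.root '' orthSimple b B) ≤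
      LinearMap.ker (B (P.root (highestRoot b))) := by
    refine Submodule.span_le.mpr ?_
    rintro _ ⟨k, hk, rfl⟩
    exact hk.2
  exact this hv

/-- The element `x⁻¹y` fixes the highest root; it is trivial once it is known to send every simple
root to a positive root. -/
theorem distinguished_unique {x y : P.weylGroup} (hx : x ∈ distinguished b B)
    (hy : y ∈ distinguished b B)
    (h : x • P.root (highestRoot b) = y • P.root (highestRoot b)) : x = y := by
  suffices x⁻¹ * y = 1 from (inv_mul_eq_one.mp this)
  refine eq_one_of_forall_ht_pos (b := b) hB fun k hk => ?_
  have hfix : (x⁻¹ * y) • P.root (highestRoot b) = P.root (highestRoot b) := by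
    rw [mul_smul, ← h, inv_smul_smul]
  obtain ⟨j, hj⟩ := exists_root_eq_smul (x⁻¹ * y) k
  have hBj : B (P.root (highestRoot b)) (P.root j) = B (P.root (highestRoot b)) (P.root k) := by
    rw [hj]
    conv_lhs => rw [← hfix]
    exact hB.invariant _ _ _
  rw [← hj, ← isPos_iff_ht]
  by_contra hneg
  obtain ⟨i, hi⟩ := exists_neg P j
  have hipos : b.IsPos i := by
    rw [isPos_iff_ht, hi, map_neg, neg_pos]
    exact not_isPos_iff_ht.mp hneg
  have h1 := highestRoot_apply_nonneg hB hipos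
  have h2 := highestRoot_dominant hB hk
  rw [hi, map_neg, hBj] at h1
  -- If `x⁻¹y` sends `k` to `-i` with `i` positive, dominance makes both `k` and `i` orthogonal to
  -- the highest root. Then `x` keeps `i` positive and `y` keeps `k` positive, although `x i = -y
  -- k`.
  have h0 : B (P.root (highestRoot b)) (P.root k) = 0 := by linarith
  have hi0 : B (P.root (highestRoot b)) (P.root i) = 0 := by
    rw [hi, map_neg, hBj, h0, neg_zero]
  obtain ⟨m, hm, em⟩ := hx i hipos (mem_span_orthSimple hB hipos hi0)
  obtain ⟨n, hn, en⟩ := hy k (Base.isPos_of_mem_support hk)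
    (Submodule.subset_span ⟨k, ⟨hk, h0⟩, rfl⟩)
  rw [hi, hj, smul_neg, ← mul_smul, mul_inv_cancel_left, en] at em
  rw [isPos_iff_ht] at hm hn
  rw [← em, map_neg] at hm
  linarith

theorem mem_distinguished {x : P.weylGroup}
    (h : ∀ k ∈ orthSimple b B, 0 < ht b (x • P.root k)) : x ∈ distinguished b B := by
  intro i hi hspan
  obtain ⟨c, hc, hc', e⟩ := exists_orthSimple_coeff hB hi (apply_eq_zero_of_mem_span hspan)
  obtain ⟨j, hj⟩ := exists_root_eq_smul x i
  refine ⟨j, ?_, hj.symm⟩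
  rw [isPos_iff_ht]
  refine lt_of_le_of_ne ?_ (ht_root_ne_zero b j).symm
  rw [hj, e, Finset.smul_sum, map_sum]
  refine Finset.sum_nonneg fun k hk => ?_
  rw [smul_real, map_smul]
  by_cases hk' : k ∈ orthSimple b B
  · exact mul_nonneg (hc k) (h k hk').le
  · rw [hc' k hk hk', zero_smul]

/-- A long root which is dominant is the highest root. -/
theorem eq_highestRoot_of_dominant {i : ι}
    (hle : B (P.root (highestRoot b)) (P.root (highestRoot b)) ≤ B (P.root i) (P.root i))
    (h : ∀ k ∈ b.support, 0 ≤ B (P.root i) (P.root k)) : i = highestRoot b := by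
  obtain ⟨c, hc, e⟩ := highestRoot_isHighest b i
  have key : ∀ v, (∀ k ∈ b.support, 0 ≤ B v (P.root k)) →
      0 ≤ B v (P.root (highestRoot b) - P.root i) := by
    intro v hv
    rw [e, map_sum]
    refine Finset.sum_nonneg fun k hk => ?_
    rw [map_smul]
    exact mul_nonneg (hc k hk) (hv k hk)
  have h1 := key _ h
  -- Writing `θ` for the highest root, dominance gives `(i|θ) ≥ (i|i)`, whence `|θ - i|² ≤ (θ|θ) -
  -- (i|i) ≤ 0`.
  have h2 : B (P.root (highestRoot b) - P.root i) (P.root (highestRoot b) - P.root i) ≤ 0 := by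
    have := hB.symm (P.root i) (P.root (highestRoot b))
    simp only [map_sub, LinearMap.sub_apply] at h1 ⊢
    linarith
  have h3 := hB.eq_zero_of_le h2
  exact P.root.injective (sub_eq_zero.mp h3).symm

omit [P.IsCrystallographic] [P.IsReduced] [P.IsIrreducible] in
theorem exists_dominant (i : ι) : ∃ j, B (P.root j) (P.root j) = B (P.root i) (P.root i) ∧
    ∀ k ∈ b.support, 0 ≤ B (P.root j) (P.root k) := by
  -- A root of greatest height among those of the given length is dominant: a reflection in a simple
  -- root pairing negatively with it would raise the height.
  obtain ⟨j, hj, hmax⟩ := Set.exists_max_image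
    {j | B (P.root j) (P.root j) = B (P.root i) (P.root i)} (fun j => ht b (P.root j))
    (Set.toFinite _) ⟨i, rfl⟩
  refine ⟨j, hj, fun k hk => ?_⟩
  have h := hmax (P.reflectionPerm k j) (by
    rw [Set.mem_ofPred_eq, P.root_reflectionPerm, hB.apply_reflection]; exact hj)
  rw [P.root_reflectionPerm, ht_reflection hk _] at h
  have h1 := hB.two_mul_apply_root_root j k
  have h2 := mul_nonneg (by linarith : 0 ≤ P.pairing j k) (hB.nonneg (P.root k))
  linarith

theorem isLong_highestRoot : IsLong P B (highestRoot b) := by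
  intro i
  obtain ⟨j, hj, hd⟩ := exists_dominant (b := b) hB i
  rw [← hj]
  rcases le_total (B (P.root (highestRoot b)) (P.root (highestRoot b)))
    (B (P.root j) (P.root j)) with h | h
  · rw [eq_highestRoot_of_dominant hB h hd]
  · exact h

end Highest

end Form

/-! ### Pairings with the coroot of a long root. -/

section LongRoot

variable {ι V N : Type*} [AddCommGroup V] [Module ℝ V] [AddCommGroup N] [Module ℝ N]
  {P : RootPairing ι ℝ V N} {B : LinearMap.BilinForm ℝ V}
  (hB : IsInvariantScalarProduct P B)

theorem IsLong.apply_eq {i j : ι} (hi : IsLong P B i) (hj : IsLong P B j) :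
    B (P.root i) (P.root i) = B (P.root j) (P.root j) := le_antisymm (hj i) (hi j)

include hB

theorem IsLong.of_reflection_eq {β γ α : ι} (hβ : IsLong P B β)
    (h : P.root α = P.reflection γ (P.root β)) : IsLong P B α := by
  intro j
  rw [h, hB.apply_reflection]
  exact hβ j

theorem IsLong.of_smul_eq {β α : ι} (hβ : IsLong P B β) {x : P.weylGroup}
    (h : P.root α = x • P.root β) : IsLong P B α := by
  intro j
  rw [h, hB.invariant]
  exact hβ j

variable [P.IsCrystallographic]

theorem IsLong.pairingIn_le_one {α γ : ι} (hα : IsLong P B α) (hne : γ ≠ α) :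
    P.pairingIn ℤ γ α ≤ 1 := by
  by_contra! hlt
  have h1 := hB.two_mul_apply_root_root γ α
  rw [← P.algebraMap_pairingIn ℤ] at h1
  have h2 : (2 : ℝ) ≤ algebraMap ℤ ℝ (P.pairingIn ℤ γ α) := by
    simp only [algebraMap_int_eq, eq_intCast]
    exact_mod_cast hlt
  have h3 := mul_le_mul_of_nonneg_right h2 (hB.nonneg (P.root α))
  -- A pairing of at least `2` means `(γ|α) ≥ (α|α)`, so `|γ - α|² ≤ (γ|γ) - (α|α) ≤ 0` by
  -- maximality of the length of `α`.
  have h4 : B (P.root γ - P.root α) (P.root γ - P.root α) ≤ 0 := by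
    have := hB.symm (P.root α) (P.root γ)
    have := hα γ
    simp only [map_sub, LinearMap.sub_apply]
    linarith
  exact hne (P.root.injective (sub_eq_zero.mp (hB.eq_zero_of_le h4)))

theorem IsLong.neg_one_le_pairingIn {α γ : ι} (hα : IsLong P B α)
    (hne : P.root γ ≠ -P.root α) : -1 ≤ P.pairingIn ℤ γ α := by
  obtain ⟨δ, hδ⟩ := exists_neg P γ
  have h1 := hα.pairingIn_le_one hB (γ := δ) (by rintro rfl; exact hne (by rw [hδ, neg_neg]))
  have h2 : P.pairingIn ℤ δ α = - P.pairingIn ℤ γ α := by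
    apply FaithfulSMul.algebraMap_injective ℤ ℝ
    rw [map_neg, P.algebraMap_pairingIn, P.algebraMap_pairingIn, ← P.root_coroot_eq_pairing, hδ,
      map_neg, LinearMap.neg_apply, P.root_coroot_eq_pairing]
  lia

end LongRoot

/-! ### How simple reflections change the level. -/

section Level

variable {ι V N : Type*} [AddCommGroup V] [Module ℝ V] [AddCommGroup N] [Module ℝ N]
  {P : RootPairing ι ℝ V N} {B : LinearMap.BilinForm ℝ V}
  [P.IsRootSystem] [P.IsCrystallographic]
  {b : P.Base}

theorem dualHeight_reflection {γ β α : ι} (hγ : γ ∈ b.support)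
    (h : P.root α = P.reflection γ (P.root β)) :
    dualHeight b α = dualHeight b β - P.pairingIn ℤ γ β := by
  have h1 : P.coroot α = P.flip.reflection γ (P.flip.root β) :=
    P.coroot_eq_coreflection_of_root_eq h
  have h2 := ht_reflection (P := P.flip) (b := b.flip) (γ := γ) hγ β
  rw [← h1] at h2
  have h3 : (dualHeight b α : ℝ) = dualHeight b β - P.pairing γ β := by
    rw [dualHeight_cast, dualHeight_cast]; exact h2
  rw [← P.algebraMap_pairingIn ℤ] at h3
  simp only [algebraMap_int_eq, eq_intCast] at h3
  exact_mod_cast h3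

omit [P.IsRootSystem] [P.IsCrystallographic] in
theorem dualHeight_neg {α β : ι} (h : P.root α = -P.root β) :
    dualHeight b α = - dualHeight b β := by
  let := P.indexNeg
  have : α = -β := P.root.injective (by simpa using h)
  rw [this]
  exact b.flip.height_reflectionPerm_self β

omit [P.IsRootSystem] [P.IsCrystallographic] in
theorem isPos_neg_iff {α β : ι} (h : P.root α = -P.root β) : b.IsPos α ↔ ¬ b.IsPos β := by
  let := P.indexNeg
  have : α = -β := P.root.injective (by simpa using h)
  rw [this]
  exact Base.IsPos.neg_iff_not b β

omit [P.IsRootSystem] [P.IsCrystallographic] in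
theorem dualHeight_of_mem_support {γ : ι} (hγ : γ ∈ b.support) : dualHeight b γ = 1 :=
  Base.height_one_of_mem_support (b := b.flip) hγ

variable [Finite ι] [P.IsReduced]

theorem isPos_reflection_iff {γ β α : ι} (hγ : γ ∈ b.support)
    (h : P.root α = P.reflection γ (P.root β)) (h1 : β ≠ γ) (h2 : P.root β ≠ -P.root γ) :
    b.IsPos α ↔ b.IsPos β := by
  by_cases hβ : b.IsPos β
  · have := ht_reflection_pos hγ hβ h1
    rw [← h, ← isPos_iff_ht] at this
    exact iff_of_true this hβ
  · obtain ⟨δ, hδ⟩ := exists_neg P β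
    have hδpos : b.IsPos δ := (isPos_neg_iff hδ).mpr hβ
    have := ht_reflection_pos hγ hδpos (by rintro rfl; exact h2 (by rw [hδ, neg_neg]))
    rw [hδ, map_neg, ← h, map_neg, neg_pos, ← not_isPos_iff_ht] at this
    exact iff_of_false this hβ

variable [P.IsIrreducible] (hB : IsInvariantScalarProduct P B)
include hB

omit hB in
theorem level_neg {α β : ι} (hβ : b.IsPos β) (h : P.root α = -P.root β) :
    level b α = level b β + (2 * dualHeight b β - 1) := by
  rw [level, level, if_pos hβ, if_neg ((isPos_neg_iff h).not.mpr (not_not.mpr hβ)),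
    dualHeight_neg h]
  ring

/-- The effect of a simple reflection on the level of a long root. -/
theorem level_reflection {γ β α : ι} (hβ : IsLong P B β) (hγ : γ ∈ b.support)
    (h : P.root α = P.reflection γ (P.root β)) :
    level b α = level b β + (P.pairingIn ℤ γ β).sign := by
  -- When `β = ±γ` the pairing is `±2` but the level moves only by `±1`; this is why the statement
  -- involves the sign.
  rcases eq_or_ne β γ with rfl | h1
  · rw [reflection_apply_self] at h
    rw [level_neg (Base.isPos_of_mem_support hγ) h, dualHeight_of_mem_support hγ]
    simp only [pairingIn_same]
    rfl
  by_cases h2 : P.root β = -P.root γ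
  · have h3 : P.root α = P.root γ := by rw [h, h2, map_neg, reflection_apply_self, neg_neg]
    have h4 : P.pairingIn ℤ γ β = -2 := by
      apply FaithfulSMul.algebraMap_injective ℤ ℝ
      have h5 : P.root γ = -P.root β := by rw [h2, neg_neg]
      rw [P.algebraMap_pairingIn, ← P.root_coroot_eq_pairing, h5, map_neg, LinearMap.neg_apply,
        P.root_coroot_eq_pairing, pairing_same]
      simp
    rw [P.root.injective h3, level_neg (Base.isPos_of_mem_support hγ) h2,
      dualHeight_of_mem_support hγ, h4, Int.sign_eq_neg_one_of_neg (by norm_num)]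
    ring
  -- Away from `±γ` the pairing equals its own sign, and `s_γ` preserves the positivity of `β`, so
  -- both levels fall under the same clause of the definition.
  · have h3 := hβ.pairingIn_le_one hB h1.symm
    have h4 := hβ.neg_one_le_pairingIn hB (γ := γ) (fun h => h2 (by rw [h, neg_neg]))
    have h5 : (P.pairingIn ℤ γ β).sign = P.pairingIn ℤ γ β := by
      interval_cases P.pairingIn ℤ γ β <;> rfl
    have h6 := isPos_reflection_iff hγ h h1 h2
    rw [h5, level, level, dualHeight_reflection hγ h]
    by_cases hp : b.IsPos β
    · rw [if_pos hp, if_pos (h6.mpr hp)]; ring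
    · rw [if_neg hp, if_neg (h6.not.mpr hp)]; ring

theorem abs_level_reflection_sub_le {γ β α : ι} (hβ : IsLong P B β) (hγ : γ ∈ b.support)
    (h : P.root α = P.reflection γ (P.root β)) : |level b α - level b β| ≤ 1 := by
  rw [level_reflection hB hβ hγ h, add_sub_cancel_left]
  rcases Int.sign_trichotomy (P.pairingIn ℤ γ β) with h | h | h <;> simp [h]

theorem abs_level_sub_le_word_length {β α : ι} (hβ : IsLong P B β) (ω : List b.support)
    (h : wordProd b ω • P.root β = P.root α) : |level b α - level b β| ≤ ω.length := by
  induction ω generalizing α with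
  | nil =>
    rw [show wordProd b [] = 1 from rfl, one_smul] at h
    simp [P.root.injective h]
  | cons γ ω ih =>
    obtain ⟨δ, hδ⟩ := exists_root_eq_smul (wordProd b ω) β
    rw [wordProd_cons, mul_smul, ← hδ, ofIdx_smul_eq] at h
    have h1 := ih hδ.symm
    have h2 := abs_level_reflection_sub_le hB (hβ.of_smul_eq hB hδ) γ.2 h.symm
    rw [List.length_cons]
    rw [abs_le] at *
    push_cast
    constructor <;> linarith

theorem abs_level_sub_le_length {β α : ι} (hβ : IsLong P B β) {x : P.weylGroup}
    (h : x • P.root β = P.root α) : |level b α - level b β| ≤ length b x := by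
  obtain ⟨ω, rfl, hl⟩ := exists_isReducedExpr b x
  rw [← hl]
  exact abs_level_sub_le_word_length hB hβ ω h

theorem level_le_of_LE {α β : ι} (hα : IsLong P B α) (hβ : IsLong P B β)
    (h : LE b (P.root α) (P.root β)) : level b β ≤ level b α := by
  have h1 := dualHeight_le_of_LE hB (hα.apply_eq hβ) h
  have h2 := dualHeight_pos_iff hB (b := b) (i := α)
  have h3 := dualHeight_pos_iff hB (b := b) (i := β)
  have h4 : dualHeight b α ≠ 0 := b.flip.height_ne_zero α
  rw [level, level]
  split_ifs with h5 h6 h6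
  · lia
  · rw [← h3] at h5; rw [← h2] at h6; lia
  · rw [← h3] at h5; rw [← h2] at h6; lia
  · lia

theorem level_nonneg {α : ι} (hα : IsLong P B α) : 0 ≤ level b α := by
  have h := level_le_of_LE hB hα (isLong_highestRoot hB) (highestRoot_isHighest b α)
  rwa [level, if_pos isPos_highestRoot, sub_self] at h

end Level

/-! ### Simple paths and minimal elements. -/

section Path

variable {ι V N : Type*} [AddCommGroup V] [Module ℝ V] [AddCommGroup N] [Module ℝ N]
  {P : RootPairing ι ℝ V N} {B : LinearMap.BilinForm ℝ V}
  [Finite ι] [P.IsRootSystem] [P.IsCrystallographic] [P.IsReduced] [P.IsIrreducible]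
  {b : P.Base}

theorem SimplePath.wordProd_smul {β α : ι} (p : SimplePath b B β α) :
    wordProd b p.word • P.root β = P.root α := by
  induction p with
  | nil hβ => exact one_smul _ _
  | snoc p γ h ih => rw [word, wordProd_cons, mul_smul, ih, ofIdx_smul_eq, h.reflection_eq]

theorem SimplePath.length_word {β α : ι} (p : SimplePath b B β α) :
    (p.word.length : ℤ) = level b α - level b β := by
  induction p with
  | nil hβ => simp [word]
  | snoc p γ h ih =>
    rw [word, List.length_cons, h.level_eq]
    push_cast
    rw [ih]
    ring

/-- The end point and the last label determine the preceding root, because a reflection is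
injective; so a path can be recovered backwards from its word. -/
theorem SimplePath.word_injective {β α : ι} (p q : SimplePath b B β α)
    (h : p.word = q.word) : p = q := by
  induction p with
  | nil hβ =>
    cases q with
    | nil => rfl
    | snoc q γ h' => simp [word] at h
  | snoc p γ hp ih =>
    cases q with
    | nil => simp [word] at h
    | snoc q γ' hq =>
      rw [word, word, List.cons.injEq] at h
      obtain ⟨rfl, h⟩ := h
      have e := P.root.injective ((P.reflection γ).injective
        (hp.reflection_eq.symm.trans hq.reflection_eq))
      subst e
      rw [ih q h]

theorem SimplePath.level_le {β α : ι} (p : SimplePath b B β α) : level b β ≤ level b α := by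
  have := p.length_word
  lia

variable (hB : IsInvariantScalarProduct P B)
include hB

theorem SimplePath.isMinimal {β α : ι} (hβ : IsLong P B β) (p : SimplePath b B β α) :
    IsMinimal b (wordProd b p.word) α β := by
  refine ⟨p.wordProd_smul, le_antisymm ?_ (abs_level_sub_le_length hB hβ p.wordProd_smul)⟩
  have h1 := length_wordProd_le b p.word
  have h2 := p.length_word
  have h3 := le_abs_self (level b α - level b β)
  lia

/-- Each letter contributes at most one to the level, so if the total rise equals the number of
letters, every letter raises the level by exactly one. -/
theorem exists_simplePath_of_word {β α : ι} (hβ : IsLong P B β) (ω : List b.support)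
    (h : wordProd b ω • P.root β = P.root α) (hl : (ω.length : ℤ) = level b α - level b β) :
    ∃ p : SimplePath b B β α, p.word = ω := by
  induction ω generalizing α with
  | nil =>
    rw [show wordProd b [] = 1 from rfl, one_smul] at h
    obtain rfl := P.root.injective h
    exact ⟨.nil β hβ, rfl⟩
  | cons γ ω ih =>
    obtain ⟨δ, hδ⟩ := exists_root_eq_smul (wordProd b ω) β
    rw [wordProd_cons, mul_smul, ← hδ, ofIdx_smul_eq] at h
    have hδl := hβ.of_smul_eq hB hδ
    have h1 := abs_level_sub_le_word_length hB hβ ω hδ.symm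
    have h2 := abs_level_reflection_sub_le hB hδl γ.2 h.symm
    rw [List.length_cons] at hl
    push_cast at hl
    rw [abs_le] at h1 h2
    obtain ⟨p, rfl⟩ := ih hδ.symm (by lia)
    exact ⟨.snoc p γ ⟨hδl, hδl.of_reflection_eq hB h.symm, Base.isPos_of_mem_support γ.2,
      h.symm, by lia⟩, rfl⟩

omit hB in
theorem IsMinimal.inv {x : P.weylGroup} {α β : ι} (h : IsMinimal b x α β) :
    IsMinimal b x⁻¹ β α :=
  ⟨by rw [← h.1, inv_smul_smul], by rw [length_inv, h.2, abs_sub_comm]⟩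

theorem IsMinimal.exists_simplePath {x : P.weylGroup} {α β : ι} (hβ : IsLong P B β)
    (h : IsMinimal b x α β) (hle : level b β ≤ level b α) {ω : List b.support}
    (hω : IsReducedExpr b x ω) : ∃ p : SimplePath b B β α, p.word = ω := by
  refine exists_simplePath_of_word hB hβ ω (hω.1 ▸ h.1) ?_
  rw [hω.2, h.2, abs_of_nonneg (by lia)]

/-- For monotone levels the level differences add up, so subadditivity of the length and the lower
bound pinch the length of the product. -/
theorem IsMinimal.mul {x y : P.weylGroup} {α β γ : ι} (hγ : IsLong P B γ)
    (hx : IsMinimal b x α β) (hy : IsMinimal b y β γ) (h1 : level b γ ≤ level b β)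
    (h2 : level b β ≤ level b α) :
    IsMinimal b (x * y) α γ ∧ length b (x * y) = length b x + length b y := by
  have e : (x * y) • P.root γ = P.root α := by rw [mul_smul, hy.1, hx.1]
  have h3 := abs_level_sub_le_length hB (b := b) hγ e
  have h4 := length_mul_le b x y
  have h5 := hx.2
  have h6 := hy.2
  rw [abs_of_nonneg (by lia)] at h3 h5 h6
  refine ⟨⟨e, ?_⟩, by lia⟩
  rw [abs_of_nonneg (by lia)]
  lia

theorem IsMinimal.mem_distinguished {x : P.weylGroup} {α : ι}
    (h : IsMinimal b x α (highestRoot b)) : x ∈ distinguished b B := by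
  refine LongRoots.mem_distinguished hB fun k hk => ?_
  by_contra hneg
  obtain ⟨j, hj⟩ := exists_root_eq_smul x k
  have h0 := ht_root_ne_zero b j
  rw [hj] at h0
  have h1 := length_mul_ofIdx_lt hB hk.1 (lt_of_le_of_ne (not_lt.mp hneg) h0)
  have h2 : P.coroot' k (P.root (highestRoot b)) = 0 := by
    have := hB.two_mul_apply_root (P.root (highestRoot b)) k
    rw [hk.2, mul_zero] at this
    exact (mul_eq_zero.mp this.symm).resolve_right (hB.root_pos k).ne'
  -- As `s_k` fixes the highest root, `x s_k` has the same effect on it as `x`, while being shorter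
  -- than the lower bound allows.
  have h3 : (x * weylGroup.ofIdx P k) • P.root (highestRoot b) = P.root α := by
    rw [mul_smul, ofIdx_smul_eq, reflection_apply, h2, zero_smul, sub_zero, h.1]
  have h4 := abs_level_sub_le_length hB (b := b) (isLong_highestRoot hB) h3
  rw [← h.2] at h4
  lia

/-- Every long root is reached from the highest root by a simple path. -/
theorem nonempty_simplePath_highestRoot {α : ι} (hα : IsLong P B α) :
    Nonempty (SimplePath b B (highestRoot b) α) := by
  obtain ⟨n, hn⟩ := Int.eq_ofNat_of_zero_le (level_nonneg hB (b := b) hα)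
  induction n using Nat.strong_induction_on generalizing α with
  | _ n ih =>
    rcases eq_or_ne α (highestRoot b) with rfl | hne
    · exact ⟨.nil _ hα⟩
    -- The highest root is the only dominant long root, so some simple `k` pairs negatively with
    -- `α`. Then `s_k` lowers the level by one, and undoing it is the last step of the path.
    obtain ⟨k, hk, hlt⟩ : ∃ k ∈ b.support, B (P.root α) (P.root k) < 0 := by
      by_contra! h
      exact hne (eq_highestRoot_of_dominant hB (hα _) h)
    have hp : P.pairingIn ℤ k α < 0 := by
      have h1 := hB.two_mul_apply_root_root k α
      rw [hB.symm, ← P.algebraMap_pairingIn ℤ] at h1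
      have h2 : algebraMap ℤ ℝ (P.pairingIn ℤ k α) < 0 := by
        by_contra! h3
        have := mul_nonneg h3 (hB.root_pos α).le
        linarith
      simpa using h2
    have e : P.root (P.reflectionPerm k α) = P.reflection k (P.root α) :=
      P.root_reflectionPerm k α
    have hβ := hα.of_reflection_eq hB e
    have hl := level_reflection hB hα hk e
    rw [Int.sign_eq_neg_one_of_neg hp] at hl
    have h0 := level_nonneg hB (b := b) hβ
    obtain ⟨p⟩ := ih (n - 1) (by lia) hβ (by lia)
    exact ⟨.snoc p ⟨k, hk⟩ ⟨hβ, hα, Base.isPos_of_mem_support hk,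
      by rw [e, reflection_same], by lia⟩⟩

theorem IsMinimal.unique {x y : P.weylGroup} {α β : ι} (hα : IsLong P B α) (hβ : IsLong P B β)
    (hx : IsMinimal b x α β) (hy : IsMinimal b y α β) : x = y := by
  have key : ∀ {α β : ι} {x y : P.weylGroup}, IsLong P B β → IsMinimal b x α β →
      IsMinimal b y α β → level b β ≤ level b α → x = y := by
    intro α β x y hβ hx hy hle
    -- Precomposing `x` and `y` with the minimal element of a path from the highest root to `β`
    -- gives two distinguished elements with the same value at the highest root; this common right
    -- factor then cancels.
    obtain ⟨p⟩ := nonempty_simplePath_highestRoot hB (b := b) hβ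
    have hθ := isLong_highestRoot (b := b) hB
    have hp := p.isMinimal hB hθ
    have h1 := (hx.mul hB hθ hp p.level_le hle).1
    have h2 := (hy.mul hB hθ hp p.level_le hle).1
    exact mul_right_cancel (distinguished_unique hB (h1.mem_distinguished hB)
      (h2.mem_distinguished hB) (h1.1.trans h2.1.symm))
  rcases le_total (level b β) (level b α) with hle | hle
  · exact key hβ hx hy hle
  · exact inv_injective (key hα hx.inv hy.inv hle)

theorem exists_isMinimal_iff {α β : ι} (hα : IsLong P B α) (hβ : IsLong P B β) :
    (∃ x : P.weylGroup, IsMinimal b x α β) ↔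
      (Nonempty (SimplePath b B β α) ∨ Nonempty (SimplePath b B α β)) := by
  constructor
  · rintro ⟨x, hx⟩
    obtain ⟨ω, hω⟩ := exists_isReducedExpr b x
    rcases le_total (level b β) (level b α) with hle | hle
    · exact .inl ⟨(hx.exists_simplePath hB hβ hle hω).choose⟩
    · exact .inr ⟨(hx.inv.exists_simplePath hB hα hle hω.reverse).choose⟩
  · rintro (⟨⟨p⟩⟩ | ⟨⟨p⟩⟩)
    · exact ⟨_, p.isMinimal hB hβ⟩
    · exact ⟨_, (p.isMinimal hB hα).inv⟩

theorem IsMinimal.bijOn_word {x : P.weylGroup} {α β : ι} (hα : IsLong P B α)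
    (hβ : IsLong P B β) (hx : IsMinimal b x α β) (hne : Nonempty (SimplePath b B β α)) :
    Set.BijOn (fun p : SimplePath b B β α => p.word) Set.univ {ω | IsReducedExpr b x ω} := by
  refine ⟨fun p _ => ?_, fun p _ q _ h => p.word_injective q h, fun ω hω => ?_⟩
  · refine ⟨(p.isMinimal hB hβ).unique hB hα hβ hx, ?_⟩
    have h1 := hx.2
    have h2 := p.length_word
    rw [← h2, Nat.abs_cast] at h1
    exact_mod_cast h1.symm
  · obtain ⟨p, hp⟩ := hx.exists_simplePath hB hβ hne.some.level_le hω
    exact ⟨p, trivial, hp⟩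

/-- Reversing words exchanges the reduced expressions of `x` and `x⁻¹`, which reduces this to the
ascending case. -/
theorem IsMinimal.bijOn_word_reverse {x : P.weylGroup} {α β : ι} (hα : IsLong P B α)
    (hβ : IsLong P B β) (hx : IsMinimal b x α β) (hne : Nonempty (SimplePath b B α β)) :
    Set.BijOn (fun p : SimplePath b B α β => p.word.reverse) Set.univ
      {ω | IsReducedExpr b x ω} := by
  have h := hx.inv.bijOn_word hB hβ hα hne
  refine ⟨fun p _ => ?_, fun p _ q _ e => ?_, fun ω hω => ?_⟩
  · simpa using (h.mapsTo (Set.mem_univ p)).reverse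
  · exact p.word_injective q (List.reverse_injective e)
  · obtain ⟨p, -, hp⟩ := h.surjOn hω.reverse
    exact ⟨p, trivial, by simp [hp]⟩

omit [P.IsIrreducible] in
-- Induction on the dual height: a positive long root that is not simple is lowered by one under
-- some `s_k` and stays positive, while `s_α = s_k s_{s_k α} s_k` costs two letters. Simple roots
-- account for the `-1`.
theorem length_ofIdx_le_of_isLong {α : ι} (hα : IsLong P B α) (hpos : b.IsPos α) :
    (length b (weylGroup.ofIdx P α) : ℤ) ≤ 2 * dualHeight b α - 1 := by
  have h0 := (dualHeight_pos_iff hB).mpr hpos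
  obtain ⟨n, hn⟩ := Int.eq_ofNat_of_zero_le h0.le
  induction n generalizing α with
  | zero => lia
  | succ n ih =>
    obtain ⟨k, hk, hp⟩ := hpos.exists_mem_support_pos_pairingIn
    rcases eq_or_ne α k with rfl | hne
    · have := length_ofIdx_le b hk
      rw [dualHeight_of_mem_support hk]
      lia
    have e : P.root (P.reflectionPerm k α) = P.reflection k (P.root α) :=
      P.root_reflectionPerm k α
    have h1 : P.pairingIn ℤ k α = 1 := by
      have := hα.pairingIn_le_one hB hne.symm
      lia
    have h2 := dualHeight_reflection hk e
    have h3 := hpos.reflectionPerm hk hne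
    have h4 := (dualHeight_pos_iff hB).mpr h3
    have h5 := ih (hα.of_reflection_eq hB e) h3 h4 (by lia)
    have h6 : P.root α = weylGroup.ofIdx P k • P.root (P.reflectionPerm k α) := by
      rw [e, ofIdx_smul_eq, reflection_same]
    rw [hB.conj_ofIdx h6, ofIdx_inv]
    have h7 := length_mul_le b (weylGroup.ofIdx P k * weylGroup.ofIdx P (P.reflectionPerm k α))
      (weylGroup.ofIdx P k)
    have h8 := length_mul_le b (weylGroup.ofIdx P k) (weylGroup.ofIdx P (P.reflectionPerm k α))
    have h9 := length_ofIdx_le b hk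
    lia

theorem isMinimal_ofIdx {α α' : ι} (hα : IsLong P B α) (hpos : b.IsPos α)
    (h : P.root α' = -P.root α) : IsMinimal b (weylGroup.ofIdx P α) α' α := by
  have e : weylGroup.ofIdx P α • P.root α = P.root α' := by
    rw [ofIdx_smul_eq, reflection_apply_self, h]
  refine ⟨e, le_antisymm ?_ (abs_level_sub_le_length hB hα e)⟩
  refine (length_ofIdx_le_of_isLong hB hα hpos).trans ?_
  rw [level_neg hpos h, add_sub_cancel_left]
  exact le_abs_self _

theorem exists_isMinimal_highestRoot {α : ι} (hα : IsLong P B α) :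
    ∃ x : P.weylGroup, IsMinimal b x α (highestRoot b) ∧
      ∀ y : P.weylGroup,
        (y ∈ distinguished b B ∧ y • P.root (highestRoot b) = P.root α) ↔ y = x := by
  obtain ⟨p⟩ := nonempty_simplePath_highestRoot hB (b := b) hα
  have hp := p.isMinimal hB (isLong_highestRoot hB)
  refine ⟨_, hp, fun y => ⟨fun h => ?_, ?_⟩⟩
  · exact distinguished_unique hB h.1 (hp.mem_distinguished hB) (h.2.trans hp.1.symm)
  · rintro rfl
    exact ⟨hp.mem_distinguished hB, hp.1⟩

end Path

end

end LongRoots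

theorem mainTheorem4 {ι V N : Type*} [Finite ι] [AddCommGroup V] [Module ℝ V]
    [AddCommGroup N] [Module ℝ N] (P : RootPairing ι ℝ V N)
    [P.IsRootSystem] [P.IsCrystallographic] [P.IsReduced] [P.IsIrreducible]
    (B : LinearMap.BilinForm ℝ V) (hB : LongRoots.IsInvariantScalarProduct P B) (b : P.Base) :
    -- the lower bound for the length
    (∀ α β : ι, LongRoots.IsLong P B α → LongRoots.IsLong P B β →
      ∀ x : P.weylGroup, x • P.root β = P.root α →
        |LongRoots.level b α - LongRoots.level b β| ≤ (LongRoots.length b x : ℤ)) ∧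
    -- existence and uniqueness of the minimal element, its reduced expressions
    (∀ α β : ι, LongRoots.IsLong P B α → LongRoots.IsLong P B β →
      ((∃ x : P.weylGroup, LongRoots.IsMinimal b x α β) ↔
        (Nonempty (LongRoots.SimplePath b B β α) ∨ Nonempty (LongRoots.SimplePath b B α β))) ∧
      (∀ x y : P.weylGroup,
        LongRoots.IsMinimal b x α β → LongRoots.IsMinimal b y α β → x = y) ∧
      (∀ x : P.weylGroup, LongRoots.IsMinimal b x α β →
        (Nonempty (LongRoots.SimplePath b B β α) →
          Set.BijOn (fun p : LongRoots.SimplePath b B β α => p.word) Set.univ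
            {ω | LongRoots.IsReducedExpr b x ω}) ∧
        (Nonempty (LongRoots.SimplePath b B α β) →
          Set.BijOn (fun p : LongRoots.SimplePath b B α β => p.word.reverse) Set.univ
            {ω | LongRoots.IsReducedExpr b x ω}))) ∧
    -- composition
    (∀ α β γ : ι, LongRoots.IsLong P B α → LongRoots.IsLong P B β → LongRoots.IsLong P B γ →
      LongRoots.LE b (P.root α) (P.root β) → LongRoots.LE b (P.root β) (P.root γ) →
      ∀ x y : P.weylGroup, LongRoots.IsMinimal b x α β → LongRoots.IsMinimal b y β γ →
        LongRoots.IsMinimal b (x * y) α γ ∧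
        LongRoots.length b (x * y) = LongRoots.length b x + LongRoots.length b y) ∧
    -- the element attached to the pair `(-α, α)` is the reflection in `α`
    (∀ α α' : ι, LongRoots.IsLong P B α → b.IsPos α → P.root α' = -P.root α →
      LongRoots.IsMinimal b (RootPairing.weylGroup.ofIdx P α) α' α) ∧
    -- the element attached to `α` and the highest root is the distinguished representative
    LongRoots.IsLong P B (LongRoots.highestRoot b) ∧
    (∀ α : ι, LongRoots.IsLong P B α →
      ∃ x : P.weylGroup, LongRoots.IsMinimal b x α (LongRoots.highestRoot b) ∧
        ∀ y : P.weylGroup,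
          (y ∈ LongRoots.distinguished b B ∧
            y • P.root (LongRoots.highestRoot b) = P.root α) ↔ y = x) := by
  refine ⟨fun α β _ hβ x hx => LongRoots.abs_level_sub_le_length hB hβ hx,
    fun α β hα hβ => ⟨LongRoots.exists_isMinimal_iff hB hα hβ,
      fun x y hx hy => hx.unique hB hα hβ hy,
      fun x hx => ⟨hx.bijOn_word hB hα hβ, hx.bijOn_word_reverse hB hα hβ⟩⟩,
    fun α β γ hα hβ hγ h1 h2 x y hx hy => hx.mul hB hγ hy
      (LongRoots.level_le_of_LE hB hβ hγ h2) (LongRoots.level_le_of_LE hB hα hβ h1),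
    fun α α' hα hpos h => LongRoots.isMinimal_ofIdx hB hα hpos h,
    LongRoots.isLong_highestRoot hB,
    fun α hα => LongRoots.exists_isMinimal_highestRoot hB hα⟩
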